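/- Let $J_1,J_2,J_3>0$, $t_{\mathrm f}>0$, and put $\alpha=\frac1{J_3}-\frac1{J_2}$, $\beta=\frac1{J_1}-\frac1{J_3}$, $\gamma=\frac1{J_2}-\frac1{J_1}$. For $x_0,x_{\mathrm f}\in\mathbb R^3$ let the Eulerian ground cost be $$c(x_0,x_{\mathrm f})=\inf_u\int_0^{t_{\mathrm f}}\tfrac12\|u(t)\|_2^2\,dt,$$ the infimum being over all controls $u\in L^2([0,t_{\mathrm f}];\mathbb R^3)$ for which there is an absolutely continuous $x:[0,t_{\mathrm f}]\to\mathbb R^3$ with $x(0)=x_0$, $x(t_{\mathrm f})=x_{\mathrm f}$ and, for almost every $t$, $$\dot x_1=\alpha x_2x_3+u_1,\qquad \dot x_2=\beta x_3x_1+u_2,\qquad \dot x_3=\gamma x_1x_2+u_3 .$$ Let $\xi_0,\xi_{\mathrm f}$ be probability density functions on $\mathbb R^3$ with finite second moments, and let $\Pi_2(\xi_0,\xi_{\mathrm f})$ be the set of Borel probability measures $\pi$ on $\mathbb R^3\times\mathbb R^3$ with finite second moment whose first and second marginals have densities $\xi_0$ and $\xi_{\mathrm f}$. Then the static (Kantorovich)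 problem $$\inf_{\pi\in\Pi_2(\xi_0,\xi_{\mathrm f})}\int_{\mathbb R^3\times\mathbb R^3}c(x_0,x_{\mathrm f})\,d\pi(x_0,x_{\mathrm f})$$ is well-posed: the infimum defining $c(x_0,x_{\mathrm f})$ is finite and attained for all $x_0,x_{\mathrm f}$, the function $c$ is Borel measurable, and there is $\pi\in\Pi_2(\xi_0,\xi_{\mathrm f})$ with $\int c\,d\pi<\infty$ and $\int c\,d\pi\le\int c\,d\pi'$ for every $\pi'\in\Pi_2(\xi_0,\xi_{\mathrm f})$. -/

import Mathlib

open MeasureTheory Set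
open scoped ENNReal

noncomputable section

namespace EulerOT

/-- The state space `ℝ³` with its Euclidean norm. -/
abbrev E3 : Type := EuclideanSpace ℝ (Fin 3)

/-- The drift of the controlled Euler equation in the angular momentum coordinates
`x = J ⊙ ω`, with `α = 1/J₃ - 1/J₂`, `β = 1/J₁ - 1/J₃`, `γ = 1/J₂ - 1/J₁`. -/
def drift (J : Fin 3 → ℝ) (x : E3) : E3 :=
  !₂[(1 / J 2 - 1 / J 1) * (x 1 * x 2),
     (1 / J 0 - 1 / J 2) * (x 2 * x 0),
     (1 / J 1 - 1 / J 0) * (x 0 * x 1)]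

/-- The control `u` has finite energy on `[0, T]`, and `x` is the corresponding (absolutely
continuous, Carathéodory) trajectory of `ẋ = drift x + u`, with `x 0 = x₀` and `x T = x₁`. -/
structure Steers (J : Fin 3 → ℝ) (T : ℝ) (x₀ x₁ : E3) (u x : ℝ → E3) : Prop where
  memLp : MemLp u 2 (volume.restrict (Icc 0 T))
  continuousOn : ContinuousOn x (Icc 0 T)
  dynamics : ∀ t ∈ Icc 0 T, x t = x₀ + ∫ s in (0 : ℝ)..t, (drift J (x s) + u s)
  terminal : x T = x₁

/-- The control effort `∫₀ᵀ ½ |u|² dt`. -/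
def energy (T : ℝ) (u : ℝ → E3) : ℝ≥0∞ :=
  ∫⁻ t in Icc 0 T, ENNReal.ofReal (1 / 2 * ‖u t‖ ^ 2)

/-- The Eulerian ground cost: the optimal value of the problem of steering `x₀` to `x₁`. -/
def groundCost (J : Fin 3 → ℝ) (T : ℝ) (x₀ x₁ : E3) : ℝ≥0∞ :=
  ⨅ (u : ℝ → E3) (x : ℝ → E3) (_ : Steers J T x₀ x₁ u x), energy T u

/-- Probability density functions on `ℝ³`. -/
structure IsPDF (ξ : E3 → ℝ) : Prop where
  nonneg : ∀ x, 0 ≤ ξ x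
  integrable : Integrable ξ
  integral_eq_one : ∫ x, ξ x = 1

/-- The probability measure with density `ξ`. -/
def law (ξ : E3 → ℝ) : Measure E3 :=
  volume.withDensity (fun x => ENNReal.ofReal (ξ x))

/-- The set `Π₂(ξ₀, ξ₁)` of couplings with finite second moment. -/
def couplings (ξ₀ ξ₁ : E3 → ℝ) : Set (Measure (E3 × E3)) :=
  {π | IsProbabilityMeasure π ∧ π.map Prod.fst = law ξ₀ ∧ π.map Prod.snd = law ξ₁ ∧
    ∫⁻ p, ENNReal.ofReal (‖p.1‖ ^ 2 + ‖p.2‖ ^ 2) ∂π < ∞}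

/-- The Kantorovich objective for the Eulerian ground cost. -/
def transportCost (J : Fin 3 → ℝ) (T : ℝ) (π : Measure (E3 × E3)) : ℝ≥0∞ :=
  ∫⁻ p, groundCost J T p.1 p.2 ∂π

end EulerOT

end

/-!
The drift is quadratic, but orthogonal to the state (`EulerOT.inner_drift`), so that only the
control changes the norm of the state. Two consequences carry the proof.

*Compactness.* Trajectories whose controls are bounded in `L²` and whose initial points are bounded
stay in a fixed ball (`EulerOT.Steers.norm_le`), and Young's inequality makes them equicontinuous.
Along an ultrafilter the controls converge weakly in `L²` and the trajectories uniformly; the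
integral equation passes to the limit, and the energy is weakly lower semicontinuous
(`EulerOT.exists_steers_of_tendsto`). This gives both optimal controls and the lower semicontinuity,
hence measurability, of the ground cost as a function of the endpoints.

*Quadratic growth.* The uncontrolled motion exists for all times, as it stays on a sphere
(`EulerOT.exists_free_flow`). Since the drift is homogeneous of degree two, a free motion scaled by
`r` and run at speed `r` solves the controlled equation with a control of norm `|r'|` times that of
the motion. Braking to rest and accelerating again in this way joins any two points with an energy
quadratic in them (`EulerOT.exists_steers_energy_le`), whereas a straight segment would need an
energy of order four, which finite second moments do not control. Hence all couplings of laws with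
finite second moments have finite cost.

Finally the set of couplings is weakly compact by Prokhorov's theorem, and integration of a
lower semicontinuous cost is weakly lower semicontinuous by the portmanteau theorem, so that an
optimal coupling exists (`EulerOT.exists_optimal_coupling`). The second moment condition on
couplings follows from the marginals.
-/

namespace EulerOT

open Filter Topology
open scoped RealInnerProductSpace NNReal

/-! ### The drift -/

lemma inner_drift (J : Fin 3 → ℝ) (x : E3) : ⟪x, drift J x⟫ = 0 := by
  simp only [drift, PiLp.inner_apply, Fin.sum_univ_three, RCLike.inner_apply, conj_trivial]
  simp
  ring

lemma drift_smul (J : Fin 3 → ℝ) (c : ℝ) (x : E3) : drift J (c • x) = c ^ 2 • drift J x := by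
  ext i
  fin_cases i <;> simp [drift] <;> ring

lemma contDiff_drift (J : Fin 3 → ℝ) {n : WithTop ℕ∞} : ContDiff ℝ n (drift J) := by
  rw [contDiff_piLp]
  intro i
  have h (j : Fin 3) : ContDiff ℝ n (fun x : E3 => x j) := contDiff_piLp_apply 2
  fin_cases i
  · exact contDiff_const.mul ((h 1).mul (h 2))
  · exact contDiff_const.mul ((h 2).mul (h 0))
  · exact contDiff_const.mul ((h 0).mul (h 1))

lemma continuous_drift (J : Fin 3 → ℝ) : Continuous (drift J) :=
  (contDiff_drift J (n := 0)).continuous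

lemma exists_norm_drift_le (J : Fin 3 → ℝ) : ∃ C : ℝ, 0 ≤ C ∧ ∀ x, ‖drift J x‖ ≤ C * ‖x‖ ^ 2 := by
  obtain ⟨C, hC⟩ := (isCompact_sphere (0 : E3) 1).exists_bound_of_continuousOn
    (continuous_drift J).continuousOn
  refine ⟨max C 0, le_max_right _ _, fun x => ?_⟩
  rcases eq_or_ne x 0 with rfl | hx
  · have := drift_smul J 0 0
    simp only [zero_smul, ne_eq, OfNat.ofNat_ne_zero, not_false_eq_true, zero_pow] at this
    simp [this]
  · have hx' : ‖x‖ ≠ 0 := norm_ne_zero_iff.2 hx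
    have h1 : x = ‖x‖ • (‖x‖⁻¹ • x) := by rw [smul_smul, mul_inv_cancel₀ hx', one_smul]
    have h2 : ‖drift J (‖x‖⁻¹ • x)‖ ≤ C := hC _ (by simp [norm_smul, hx'])
    rw [h1, drift_smul, ← h1, norm_smul, mul_comm]
    simp only [norm_pow, norm_norm]
    gcongr
    exact h2.trans (le_max_left _ _)

/-! ### A priori bounds on trajectories -/

lemma sq_eq_of_eq_integral {T a : ℝ} {f g : ℝ → ℝ}
    (hg : IntervalIntegrable g volume 0 T) (hf : ∀ t ∈ Icc 0 T, f t = a + ∫ s in (0 : ℝ)..t, g s)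
    {t : ℝ} (ht : t ∈ Icc 0 T) : f t ^ 2 = a ^ 2 + 2 * ∫ s in (0 : ℝ)..t, f s * g s := by
  have hsub : uIcc 0 t ⊆ uIcc 0 T := by
    rw [uIcc_of_le ht.1, uIcc_of_le (ht.1.trans ht.2)]; exact Icc_subset_Icc_right ht.2
  have hgt : IntervalIntegrable g volume 0 t := hg.mono_set hsub
  set F : ℝ → ℝ := fun t => a + ∫ s in (0 : ℝ)..t, g s with hF
  have hac : AbsolutelyContinuousOnInterval F 0 t :=
    AbsolutelyContinuousOnInterval.add (f := fun _ => a)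
      ((LipschitzWith.const a).lipschitzOnWith.absolutelyContinuousOnInterval)
      (hgt.absolutelyContinuousOnInterval_intervalIntegral left_mem_uIcc)
  have h := hac.integral_deriv_mul_eq_sub hac
  have h' : ∫ s in (0 : ℝ)..t, (deriv F s * F s + F s * deriv F s)
      = ∫ s in (0 : ℝ)..t, 2 * (f s * g s) := by
    apply intervalIntegral.integral_congr_ae
    filter_upwards [hgt.ae_hasDerivAt_integral] with s hs hs'
    have hs1 : s ∈ uIcc 0 t := uIoc_subset_uIcc hs'
    have hd : deriv F s = g s := ((hs hs1 0 left_mem_uIcc).const_add a).deriv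
    have : f s = F s := hf s (by
      have := hsub hs1; rwa [uIcc_of_le (ht.1.trans ht.2)] at this)
    rw [hd, this]; ring
  rw [h', intervalIntegral.integral_const_mul] at h
  have hF0 : F 0 = a := by simp [hF]
  rw [hf t ht]
  change F t ^ 2 = _
  rw [hF0] at h
  linarith

/-- The fundamental theorem of calculus for `‖x‖ ^ 2` along an absolutely continuous curve. -/
lemma norm_sq_eq_of_eq_integral {T : ℝ} {a : E3} {x g : ℝ → E3}
    (hx : ContinuousOn x (Icc 0 T))
    (hg : IntervalIntegrable g volume 0 T) (hf : ∀ t ∈ Icc 0 T, x t = a + ∫ s in (0 : ℝ)..t, g s)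
    {t : ℝ} (ht : t ∈ Icc 0 T) : ‖x t‖ ^ 2 = ‖a‖ ^ 2 + 2 * ∫ s in (0 : ℝ)..t, ⟪x s, g s⟫ := by
  have hsub : uIcc 0 t ⊆ uIcc 0 T := by
    rw [uIcc_of_le ht.1, uIcc_of_le (ht.1.trans ht.2)]; exact Icc_subset_Icc_right ht.2
  have hgi (i : Fin 3) : IntervalIntegrable (fun s => g s i) volume 0 T :=
    ⟨(EuclideanSpace.proj (𝕜 := ℝ) i).integrable_comp hg.1,
      (EuclideanSpace.proj (𝕜 := ℝ) i).integrable_comp hg.2⟩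
  have hi (i : Fin 3) : x t i ^ 2 = a i ^ 2 + 2 * ∫ s in (0 : ℝ)..t, x s i * g s i := by
    refine sq_eq_of_eq_integral (f := fun s => x s i) (a := a i) (hgi i) (fun r hr => ?_) ht
    have hsub' : uIcc 0 r ⊆ uIcc 0 T := by
      rw [uIcc_of_le hr.1, uIcc_of_le (hr.1.trans hr.2)]; exact Icc_subset_Icc_right hr.2
    have := (EuclideanSpace.proj (𝕜 := ℝ) i).intervalIntegral_comp_comm (hg.mono_set hsub')
    have h2 : x r i = a i + (∫ s in (0 : ℝ)..r, g s) i := by rw [hf r hr]; rfl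
    rw [h2]
    exact congrArg (a i + ·) this.symm
  have hint (i : Fin 3) : IntervalIntegrable (fun s => x s i * g s i) volume 0 t := by
    refine ((hgi i).mono_set hsub).continuousOn_mul ?_
    refine ((EuclideanSpace.proj (𝕜 := ℝ) i).continuous.comp_continuousOn hx).mono ?_
    rw [uIcc_of_le ht.1]; exact Icc_subset_Icc_right ht.2
  have hinner : ∫ s in (0 : ℝ)..t, ⟪x s, g s⟫ = ∑ i, ∫ s in (0 : ℝ)..t, x s i * g s i := by
    rw [← intervalIntegral.integral_finsetSum fun i _ => hint i]
    simp only [PiLp.inner_apply, RCLike.inner_apply, conj_trivial, mul_comm]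
  rw [hinner, EuclideanSpace.real_norm_sq_eq, EuclideanSpace.real_norm_sq_eq, Finset.mul_sum,
    ← Finset.sum_add_distrib]
  exact Finset.sum_congr rfl fun i _ => hi i

namespace Steers

variable {J : Fin 3 → ℝ} {T : ℝ} {x₀ x₁ : E3} {u x : ℝ → E3}

lemma intervalIntegrable_control (h : Steers J T x₀ x₁ u x) {s t : ℝ} (hs : s ∈ Icc 0 T)
    (ht : t ∈ Icc 0 T) : IntervalIntegrable u volume s t := by
  have h1 : IntegrableOn u (Icc 0 T) := h.memLp.integrable one_le_two
  exact (h1.mono_set (uIcc_subset_Icc hs ht)).intervalIntegrable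

lemma intervalIntegrable_drift (h : Steers J T x₀ x₁ u x) {s t : ℝ} (hs : s ∈ Icc 0 T)
    (ht : t ∈ Icc 0 T) : IntervalIntegrable (fun r => drift J (x r)) volume s t :=
  (((continuous_drift J).comp_continuousOn h.continuousOn).mono
    (uIcc_subset_Icc hs ht)).intervalIntegrable

lemma sub_eq (h : Steers J T x₀ x₁ u x) {s t : ℝ} (hs : s ∈ Icc 0 T) (ht : t ∈ Icc 0 T) :
    x t - x s = (∫ r in s..t, drift J (x r)) + ∫ r in s..t, u r := by
  have h0 : (0 : ℝ) ∈ Icc 0 T := ⟨le_rfl, hs.1.trans hs.2⟩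
  have hi {a b : ℝ} (ha : a ∈ Icc 0 T) (hb : b ∈ Icc 0 T) :
      IntervalIntegrable (fun r => drift J (x r) + u r) volume a b :=
    (h.intervalIntegrable_drift ha hb).add (h.intervalIntegrable_control ha hb)
  rw [← intervalIntegral.integral_add (h.intervalIntegrable_drift hs ht)
    (h.intervalIntegrable_control hs ht), h.dynamics t ht, h.dynamics s hs,
    add_sub_add_left_eq_sub, intervalIntegral.integral_interval_sub_left (hi h0 ht) (hi h0 hs)]

/-- As the drift is orthogonal to the state, only the control changes the norm of the state. -/
lemma norm_le (h : Steers J T x₀ x₁ u x) {t : ℝ} (ht : t ∈ Icc 0 T) :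
    ‖x t‖ ≤ ‖x₀‖ + 2 * ∫ s in Icc 0 T, ‖u s‖ := by
  have hT : 0 ≤ T := ht.1.trans ht.2
  have h0 : (0 : ℝ) ∈ Icc 0 T := ⟨le_rfl, hT⟩
  have hTT : T ∈ Icc 0 T := ⟨hT, le_rfl⟩
  have hu : IntegrableOn u (Icc 0 T) := h.memLp.integrable one_le_two
  set A := ∫ s in Icc 0 T, ‖u s‖ with hA
  have hA0 : 0 ≤ A := integral_nonneg fun _ => norm_nonneg _
  -- the estimate is closed at a time where the norm is maximal
  obtain ⟨r, hr, hmax⟩ := isCompact_Icc.exists_isMaxOn ⟨t, ht⟩ h.continuousOn.norm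
  have hmax' : ∀ s ∈ Icc 0 T, ‖x s‖ ≤ ‖x r‖ := fun s hs => hmax hs
  have key := norm_sq_eq_of_eq_integral h.continuousOn
    ((h.intervalIntegrable_drift h0 hTT).add (h.intervalIntegrable_control h0 hTT)) h.dynamics hr
  have hle : ∫ s in (0 : ℝ)..r, ⟪x s, drift J (x s) + u s⟫ ≤ ‖x r‖ * A := by
    have hsub : Ioc 0 r ⊆ Icc 0 T := fun s hs => ⟨hs.1.le, hs.2.trans hr.2⟩
    rw [intervalIntegral.integral_of_le hr.1]
    calc ∫ s in Ioc 0 r, ⟪x s, drift J (x s) + u s⟫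
        ≤ ∫ s in Ioc 0 r, ‖x r‖ * ‖u s‖ := by
          refine (Real.le_norm_self _).trans (norm_integral_le_of_norm_le
            ((hu.mono_set hsub).norm.const_mul _) ?_)
          filter_upwards [ae_restrict_mem measurableSet_Ioc] with s hs
          rw [inner_add_right, inner_drift, zero_add]
          exact (norm_inner_le_norm _ _).trans
            (mul_le_mul_of_nonneg_right (hmax' s (hsub hs)) (norm_nonneg _))
      _ ≤ ∫ s in Icc 0 T, ‖x r‖ * ‖u s‖ :=
          setIntegral_mono_set (hu.norm.const_mul _)
            (Eventually.of_forall fun s => by positivity) hsub.eventuallyLE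
      _ = ‖x r‖ * A := integral_const_mul _ _
  have : ‖x r‖ ≤ ‖x₀‖ + 2 * A := by
    nlinarith [norm_nonneg x₀, norm_nonneg (x r)]
  exact (hmax' t ht).trans this

end Steers

/-! ### Compactness of trajectories with bounded energy -/

/-- Bounded sequences in a Hilbert space converge weakly along every ultrafilter. -/
lemma exists_weak_limit {H : Type*} [NormedAddCommGroup H] [InnerProductSpace ℝ H]
    [CompleteSpace H] (𝒰 : Ultrafilter ℕ) {U : ℕ → H} {R : ℝ} (hU : ∀ n, ‖U n‖ ≤ R) :
    ∃ V : H, ∀ φ : H, Tendsto (fun n => ⟪φ, U n⟫) 𝒰 (𝓝 ⟪φ, V⟫) := by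
  set W : ℕ → WeakDual ℝ H := fun n =>
    StrongDual.toWeakDual (InnerProductSpace.toDual ℝ H (U n)) with hW
  have hcomp := WeakDual.isCompact_closedBall (𝕜 := ℝ) (0 : StrongDual ℝ H) R
  obtain ⟨f, -, hf⟩ := hcomp.ultrafilter_le_nhds (𝒰.map W) (by
    rw [le_principal_iff]
    refine mem_map.2 (Eventually.of_forall fun n => ?_)
    simpa [hW] using hU n)
  refine ⟨(InnerProductSpace.toDual ℝ H).symm (WeakDual.toStrongDual f), fun φ => ?_⟩
  have h1 : Tendsto W 𝒰 (𝓝 f) := hf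
  have h2 := ((WeakDual.eval_continuous φ).tendsto f).comp h1
  rw [real_inner_comm, InnerProductSpace.toDual_symm_apply]
  refine h2.congr fun n => ?_
  rw [real_inner_comm]
  rfl

/-- The norm is weakly lower semicontinuous. -/
lemma norm_le_of_weak_limit {H : Type*} [NormedAddCommGroup H] [InnerProductSpace ℝ H]
    {ι : Type*} {l : Filter ι} [l.NeBot] {U : ι → H} {V : H}
    (hV : ∀ φ : H, Tendsto (fun n => ⟪φ, U n⟫) l (𝓝 ⟪φ, V⟫)) {r : ι → ℝ} {R : ℝ}
    (hU : ∀ n, ‖U n‖ ≤ r n) (hr : Tendsto r l (𝓝 R)) : ‖V‖ ≤ R := by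
  have h : ⟪V, V⟫ ≤ ‖V‖ * R := le_of_tendsto_of_tendsto' (hV V) (hr.const_mul _) fun n =>
    (real_inner_le_norm _ _).trans (mul_le_mul_of_nonneg_left (hU n) (norm_nonneg _))
  have hR : 0 ≤ R := ge_of_tendsto' hr fun n => (norm_nonneg _).trans (hU n)
  rw [real_inner_self_eq_norm_sq] at h
  by_contra! hlt
  nlinarith

/-- In contrast to dominated convergence, this needs no countability of the filter, and so applies
to ultrafilters. -/
lemma tendsto_intervalIntegral_of_tendstoUniformlyOn {ι E : Type*} [NormedAddCommGroup E]
    [NormedSpace ℝ E] {l : Filter ι} {F : ι → ℝ → E} {f : ℝ → E} {a b : ℝ} (hab : a ≤ b)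
    (hF : ∀ i, ContinuousOn (F i) (Icc a b)) (hf : ContinuousOn f (Icc a b))
    (h : TendstoUniformlyOn F f l (Icc a b)) :
    Tendsto (fun i => ∫ t in a..b, F i t) l (𝓝 (∫ t in a..b, f t)) := by
  rw [Metric.tendsto_nhds]
  intro ε hε
  have hpos : 0 < b - a + 1 := by linarith
  filter_upwards [Metric.tendstoUniformlyOn_iff.1 h (ε / (b - a + 1)) (by positivity)] with i hi
  rw [dist_eq_norm, ← intervalIntegral.integral_sub ((hF i).intervalIntegrable_of_Icc hab)
    (hf.intervalIntegrable_of_Icc hab)]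
  have hb : ∀ t ∈ uIoc a b, ‖F i t - f t‖ ≤ ε / (b - a + 1) := by
    intro t ht
    rw [uIoc_of_le hab] at ht
    rw [← dist_eq_norm, dist_comm]
    exact (hi t (Ioc_subset_Icc_self ht)).le
  refine (intervalIntegral.norm_integral_le_of_norm_le_const hb).trans_lt ?_
  rw [abs_of_nonneg (by linarith), div_mul_eq_mul_div, div_lt_iff₀ hpos]
  nlinarith

lemma norm_toLp_sq {T : ℝ} {u : ℝ → E3} (hu : MemLp u 2 (volume.restrict (Icc 0 T))) :
    ‖hu.toLp‖ ^ 2 = ∫ t in Icc 0 T, ‖u t‖ ^ 2 := by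
  rw [← real_inner_self_eq_norm_sq, L2.inner_def]
  refine integral_congr_ae ?_
  filter_upwards [hu.coeFn_toLp] with t ht
  rw [ht, real_inner_self_eq_norm_sq]

lemma energy_eq {T : ℝ} {u : ℝ → E3} (hu : MemLp u 2 (volume.restrict (Icc 0 T))) :
    energy T u = ENNReal.ofReal (1 / 2 * ‖hu.toLp‖ ^ 2) := by
  rw [norm_toLp_sq, ← integral_const_mul, energy, ofReal_integral_eq_lintegral_ofReal]
  · exact (hu.integrable_norm_pow two_ne_zero).const_mul _
  · exact Eventually.of_forall fun t => by positivity

namespace Steers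

variable {J : Fin 3 → ℝ} {T : ℝ} {x₀ x₁ : E3} {u x : ℝ → E3}

/-- Young's inequality for the `L¹` norm of the control on a subinterval. -/
lemma integral_norm_control_le (h : Steers J T x₀ x₁ u x) {K : ℝ}
    (hK : ‖h.memLp.toLp‖ ^ 2 ≤ K) {s t η : ℝ} (hs : 0 ≤ s) (hst : s ≤ t) (ht : t ≤ T)
    (hη : 0 < η) : ∫ r in s..t, ‖u r‖ ≤ (t - s) / η + η * K := by
  have hsub : Ioc s t ⊆ Icc 0 T := fun r hr => ⟨hs.trans hr.1.le, hr.2.trans ht⟩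
  have hu : IntegrableOn u (Icc 0 T) := h.memLp.integrable one_le_two
  have hu2 : IntegrableOn (fun r => ‖u r‖ ^ 2) (Icc 0 T) :=
    h.memLp.integrable_norm_pow two_ne_zero
  have hconst : IntegrableOn (fun _ : ℝ => 1 / η) (Ioc s t) := integrableOn_const (by simp)
  have hsq : ∫ r in Ioc s t, ‖u r‖ ^ 2 ≤ K := by
    rw [norm_toLp_sq] at hK
    exact (setIntegral_mono_set hu2 (Eventually.of_forall fun r => by positivity)
      hsub.eventuallyLE).trans hK
  rw [intervalIntegral.integral_of_le hst]
  calc ∫ r in Ioc s t, ‖u r‖ ≤ ∫ r in Ioc s t, (1 / η + η * ‖u r‖ ^ 2) := by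
        refine setIntegral_mono (hu.mono_set hsub).norm
          (hconst.add ((hu2.mono_set hsub).const_mul η)) fun r => ?_
        change ‖u r‖ ≤ 1 / η + η * ‖u r‖ ^ 2
        have h1 : 0 ≤ (η * ‖u r‖ - 1) ^ 2 / η := by positivity
        have h2 : (η * ‖u r‖ - 1) ^ 2 / η = η * ‖u r‖ ^ 2 - 2 * ‖u r‖ + 1 / η := by
          field_simp
          ring
        linarith [norm_nonneg (u r)]
    _ = (t - s) / η + η * ∫ r in Ioc s t, ‖u r‖ ^ 2 := by
        rw [integral_add hconst ((hu2.mono_set hsub).const_mul η), integral_const_mul,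
          setIntegral_const, Real.volume_real_Ioc_of_le hst, smul_eq_mul, mul_one_div]
    _ ≤ (t - s) / η + η * K := by gcongr

/-- Equicontinuity: for bounded `K` and `D` the right-hand side is small when first `η` and then
`dist s t` is small. -/
lemma dist_le (h : Steers J T x₀ x₁ u x) {K D : ℝ} (hK : ‖h.memLp.toLp‖ ^ 2 ≤ K)
    (hD : ∀ t ∈ Icc 0 T, ‖drift J (x t)‖ ≤ D) {η : ℝ} (hη : 0 < η) {s t : ℝ}
    (hs : s ∈ Icc 0 T) (ht : t ∈ Icc 0 T) :
    dist (x s) (x t) ≤ (D + 1 / η) * dist s t + η * K := by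
  wlog hst : s ≤ t generalizing s t
  · rw [dist_comm, dist_comm s]
    exact this ht hs (le_of_not_ge hst)
  have h1 : ‖∫ r in s..t, drift J (x r)‖ ≤ D * |t - s| :=
    intervalIntegral.norm_integral_le_of_norm_le_const fun r hr => by
      rw [uIoc_of_le hst] at hr
      exact hD r ⟨hs.1.trans hr.1.le, hr.2.trans ht.2⟩
  have h2 : ‖∫ r in s..t, u r‖ ≤ (t - s) / η + η * K :=
    (intervalIntegral.norm_integral_le_integral_norm hst).trans
      (h.integral_norm_control_le hK hs.1 hst ht.2 hη)
  rw [dist_comm (x s), dist_comm s, dist_eq_norm, h.sub_eq hs ht, Real.dist_eq]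
  rw [abs_of_nonneg (sub_nonneg.2 hst)] at h1 ⊢
  calc _ ≤ D * (t - s) + ((t - s) / η + η * K) := (norm_add_le _ _).trans (add_le_add h1 h2)
    _ = _ := by ring

end Steers

/-- Limits of trajectories with converging endpoints and energy bounds are trajectories. -/
theorem exists_steers_of_tendsto {J : Fin 3 → ℝ} {T : ℝ} (hT : 0 < T) {a b : ℕ → E3}
    {x₀ x₁ : E3} {u x : ℕ → ℝ → E3} {M : ℕ → ℝ≥0} {m : ℝ≥0} (ha : Tendsto a atTop (𝓝 x₀))
    (hb : Tendsto b atTop (𝓝 x₁)) (hM : Tendsto M atTop (𝓝 m))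
    (h : ∀ n, Steers J T (a n) (b n) (u n) (x n)) (hE : ∀ n, energy T (u n) ≤ M n) :
    ∃ u' x', Steers J T x₀ x₁ u' x' ∧ energy T u' ≤ m := by
  have h0 : (0 : ℝ) ∈ Icc 0 T := ⟨le_rfl, hT.le⟩
  set U : ℕ → Lp E3 2 (volume.restrict (Icc 0 T)) := fun n => (h n).memLp.toLp with hU
  have hUM (n : ℕ) : ‖U n‖ ^ 2 ≤ 2 * M n := by
    have := hE n
    rw [energy_eq (h n).memLp, ENNReal.ofReal_le_iff_le_toReal ENNReal.coe_ne_top,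
      ENNReal.coe_toReal] at this
    linarith
  obtain ⟨N, hN⟩ : ∃ N : ℝ, ∀ n, (M n : ℝ) ≤ N := by
    obtain ⟨N, hN⟩ := hM.bddAbove_range
    exact ⟨N, fun n => by exact_mod_cast hN ⟨n, rfl⟩⟩
  have hUN (n : ℕ) : ‖U n‖ ^ 2 ≤ 2 * N := (hUM n).trans (by linarith [hN n])
  -- an ultrafilter gives weak and pointwise limits without passing to subsequences
  set 𝒰 : Ultrafilter ℕ := hyperfilter ℕ with h𝒰
  have hle : (𝒰 : Filter ℕ) ≤ atTop := Nat.hyperfilter_le_atTop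
  obtain ⟨V, hV⟩ := exists_weak_limit 𝒰 (U := U) (R := √(2 * N)) fun n =>
    Real.le_sqrt_of_sq_le (hUN n)
  have hVm : ‖V‖ ≤ √(2 * m) := by
    refine norm_le_of_weak_limit hV (r := fun n => √(2 * M n))
      (fun n => Real.le_sqrt_of_sq_le (hUM n)) ?_
    exact ((Real.continuous_sqrt.tendsto _).comp
      ((NNReal.tendsto_coe.2 hM).const_mul 2)).mono_left hle
  -- the trajectories are uniformly bounded and equicontinuous
  obtain ⟨B, hB⟩ : ∃ B, ∀ n, ∀ t ∈ Icc 0 T, ‖x n t‖ ≤ B := by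
    obtain ⟨A, hA⟩ := ha.norm.bddAbove_range
    refine ⟨A + 2 * (T / 1 + 1 * (2 * N)), fun n t ht => ((h n).norm_le ht).trans ?_⟩
    have h1 : ‖a n‖ ≤ A := hA ⟨n, rfl⟩
    have h2 := (h n).integral_norm_control_le (hUN n) le_rfl hT.le le_rfl one_pos
    rw [intervalIntegral.integral_of_le hT.le, ← integral_Icc_eq_integral_Ioc, sub_zero] at h2
    linarith
  obtain ⟨D, hD⟩ : ∃ D, ∀ n, ∀ t ∈ Icc 0 T, ‖drift J (x n t)‖ ≤ D := by
    obtain ⟨D, hD⟩ := (isCompact_closedBall (0 : E3) B).exists_bound_of_continuousOn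
      (continuous_drift J).continuousOn
    exact ⟨D, fun n t ht => hD _ (mem_closedBall_zero_iff.2 (hB n t ht))⟩
  have hequi : Equicontinuous fun (n : ℕ) (t : Icc 0 T) => x n t := by
    refine UniformEquicontinuous.equicontinuous ?_
    rw [Metric.uniformEquicontinuous_iff]
    intro ε hε
    have hN0 : 0 ≤ 2 * N := (sq_nonneg _).trans (hUN 0)
    have hD0 : 0 ≤ D := (norm_nonneg _).trans (hD 0 0 h0)
    set η : ℝ := ε / (2 * (2 * N + 1)) with hη
    have hηpos : 0 < η := by positivity
    have hηN : η * (2 * N) < ε / 2 := by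
      rw [hη, div_mul_eq_mul_div, div_lt_iff₀ (by positivity)]
      nlinarith
    have hC : 0 < D + 1 / η := by positivity
    refine ⟨ε / (2 * (D + 1 / η)), by positivity, fun s t hst n => ?_⟩
    refine ((h n).dist_le (hUN n) (hD n) hηpos s.2 t.2).trans_lt ?_
    have h1 : (D + 1 / η) * dist (s : ℝ) t < ε / 2 := by
      have : dist (s : ℝ) t < ε / (2 * (D + 1 / η)) := hst
      rw [lt_div_iff₀ (by positivity)] at this
      linarith
    linarith
  have hlim (t : ℝ) : ∃ y, t ∈ Icc 0 T → Tendsto (fun n => x n t) 𝒰 (𝓝 y) := by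
    by_cases ht : t ∈ Icc 0 T
    · obtain ⟨y, -, hy⟩ := (isCompact_closedBall (0 : E3) B).ultrafilter_le_nhds
        (𝒰.map fun n => x n t) (by
          rw [le_principal_iff]
          exact mem_map.2 <| Eventually.of_forall fun n => mem_closedBall_zero_iff.2 (hB n t ht))
      exact ⟨y, fun _ => hy⟩
    · exact ⟨0, fun h => absurd h ht⟩
  choose X hX using hlim
  have hpi : Tendsto (fun (n : ℕ) (t : Icc 0 T) => x n t) 𝒰 (𝓝 fun t : Icc 0 T => X t) :=
    tendsto_pi_nhds.2 fun t => hX t t.2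
  have hXc : ContinuousOn X (Icc 0 T) :=
    continuousOn_iff_continuous_domRestrict.2 (hpi.continuous_of_equicontinuous hequi)
  have hunif : TendstoUniformlyOn x X 𝒰 (Icc 0 T) := by
    rw [tendstoUniformlyOn_iff_tendstoUniformly_comp_coe]
    exact UniformFun.tendsto_iff_tendstoUniformly.1
      ((hequi.tendsto_uniformFun_iff_pi _ _).2 hpi)
  have hXB : ∀ t ∈ Icc 0 T, X t ∈ Metric.closedBall (0 : E3) B := fun t ht =>
    Metric.isClosed_closedBall.mem_of_tendsto (hX t ht)
      (Eventually.of_forall fun n => mem_closedBall_zero_iff.2 (hB n t ht))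
  have hdrift : TendstoUniformlyOn (fun n t => drift J (x n t)) (fun t => drift J (X t)) 𝒰
      (Icc 0 T) := by
    have huc : UniformContinuousOn (drift J) (Metric.closedBall 0 B) :=
      (isCompact_closedBall (0 : E3) B).uniformContinuousOn_of_continuous
        (continuous_drift J).continuousOn
    rw [Metric.tendstoUniformlyOn_iff]
    intro ε hε
    obtain ⟨δ, hδ, hδε⟩ := Metric.uniformContinuousOn_iff.1 huc ε hε
    filter_upwards [Metric.tendstoUniformlyOn_iff.1 hunif δ hδ] with n hn t ht
    exact hδε _ (hXB t ht) _ (mem_closedBall_zero_iff.2 (hB n t ht)) (hn t ht)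
  have hctrl : ∀ t ∈ Icc 0 T, Tendsto (fun n => ∫ s in (0 : ℝ)..t, u n s) 𝒰
      (𝓝 (∫ s in (0 : ℝ)..t, V s)) := by
    intro t ht
    have hsub : Icc 0 t ⊆ Icc 0 T := Icc_subset_Icc_right ht.2
    -- testing against `c • 1_[0,t]` gives the weak convergence of the primitives
    have hinner (c : E3) (f : Lp E3 2 (volume.restrict (Icc 0 T))) :
        ⟪indicatorConstLp 2 (μ := volume.restrict (Icc 0 T)) (measurableSet_Icc (a := 0) (b := t))
          (measure_ne_top _ _) c, f⟫ = ⟪c, ∫ s in (0 : ℝ)..t, f s⟫ := by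
      rw [L2.inner_indicatorConstLp_eq_inner_setIntegral, Measure.restrict_restrict_of_subset hsub,
        integral_Icc_eq_integral_Ioc, intervalIntegral.integral_of_le ht.1]
    have hUu (n : ℕ) : ∫ s in (0 : ℝ)..t, U n s = ∫ s in (0 : ℝ)..t, u n s := by
      rw [intervalIntegral.integral_of_le ht.1, intervalIntegral.integral_of_le ht.1]
      exact integral_congr_ae (ae_restrict_of_ae_restrict_of_subset
        (Ioc_subset_Icc_self.trans hsub) (h n).memLp.coeFn_toLp)
    have hcoord (i : Fin 3) : Tendsto (fun n => (∫ s in (0 : ℝ)..t, u n s) i) 𝒰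
        (𝓝 ((∫ s in (0 : ℝ)..t, V s) i)) := by
      have := hV (indicatorConstLp 2 (measurableSet_Icc (a := 0) (b := t))
        (measure_ne_top _ _) (EuclideanSpace.single i 1))
      simp only [hinner, hUu, EuclideanSpace.inner_single_left, map_one, one_mul] at this
      exact this
    exact ((PiLp.continuous_toLp 2 _).tendsto _).comp (tendsto_pi_nhds.2 hcoord)
  refine ⟨V, X, ⟨Lp.memLp V, hXc, fun t ht => ?_, ?_⟩, ?_⟩
  · have hsub : Icc 0 t ⊆ Icc 0 T := Icc_subset_Icc_right ht.2
    have hd := tendsto_intervalIntegral_of_tendstoUniformlyOn ht.1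
      (fun n => ((continuous_drift J).comp_continuousOn (h n).continuousOn).mono hsub)
      (((continuous_drift J).comp_continuousOn hXc).mono hsub) (hdrift.mono hsub)
    have hlim2 := (ha.mono_left hle).add (hd.add (hctrl t ht))
    rw [intervalIntegral.integral_add]
    · refine tendsto_nhds_unique (hX t ht) (hlim2.congr fun n => ?_)
      rw [(h n).dynamics t ht, intervalIntegral.integral_add ((h n).intervalIntegrable_drift h0 ht)
        ((h n).intervalIntegrable_control h0 ht)]
      rfl
    · exact (((continuous_drift J).comp_continuousOn hXc).mono hsub).intervalIntegrable_of_Icc ht.1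
    · have h1 : IntegrableOn V (Icc 0 T) := (Lp.memLp V).integrable one_le_two
      exact (h1.mono_set (uIcc_subset_Icc h0 ht)).intervalIntegrable
  · refine tendsto_nhds_unique (hX T ⟨hT.le, le_rfl⟩) ((hb.mono_left hle).congr fun n => ?_)
    exact (h n).terminal.symm
  · rw [energy_eq (Lp.memLp V), Lp.toLp_coeFn]
    have : ‖V‖ ^ 2 ≤ 2 * m := by
      have := pow_le_pow_left₀ (norm_nonneg V) hVm 2
      rwa [Real.sq_sqrt (by positivity)] at this
    refine ENNReal.ofReal_le_of_le_toReal ?_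
    rw [ENNReal.coe_toReal]
    linarith

/-! ### An upper bound on the ground cost -/

/-- The uncontrolled Euler equation is solvable on every time interval, as its solutions stay on
spheres. -/
lemma exists_free_flow (J : Fin 3 → ℝ) {S : ℝ} (hS : 0 < S) (p : E3) :
    ∃ y : ℝ → E3, y 0 = p ∧ (∀ t ∈ Icc (-S) S, ‖y t‖ = ‖p‖) ∧
      ∀ t ∈ Icc (-S) S, HasDerivWithinAt y (drift J (y t)) (Icc (-S) S) t := by
  obtain ⟨C, hC0, hC⟩ := exists_norm_drift_le J
  -- a bounded field which is orthogonal to the state and equals the drift on the sphere of `p`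
  set k : ℝ := 1 + ‖p‖ ^ 2 with hk
  have hk0 : 0 < k := by positivity
  set f : E3 → E3 := fun x => (k / (1 + ‖x‖ ^ 2)) • drift J x with hf
  have hsm : ContDiff ℝ 1 f :=
    (contDiff_const.div (contDiff_const.add (contDiff_norm_sq ℝ))
      fun x => by positivity).smul (contDiff_drift J)
  have hbound (x : E3) : ‖f x‖ ≤ k * C := by
    have h1 : 0 < 1 + ‖x‖ ^ 2 := by positivity
    rw [hf, norm_smul, Real.norm_of_nonneg (by positivity), div_mul_eq_mul_div, div_le_iff₀ h1,
      mul_assoc]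
    refine mul_le_mul_of_nonneg_left ((hC x).trans ?_) hk0.le
    nlinarith
  -- as the field is bounded everywhere, the radius can be chosen large enough for the time `S`
  set a : ℝ≥0 := ⟨k * C * S, by positivity⟩ with ha
  obtain ⟨K, hK⟩ := hsm.contDiffOn.exists_lipschitzOnWith (s := Metric.closedBall p a)
    one_ne_zero (convex_closedBall _ _) (isCompact_closedBall _ _)
  have hpl : IsPicardLindelof (fun _ => f) (tmin := -S) (tmax := S) ⟨0, by simp [hS.le]⟩ p a 0
      ⟨k * C, by positivity⟩ K :=
    { lipschitzOnWith := fun _ _ => hK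
      continuousOn := fun _ _ => continuousOn_const
      norm_le := fun _ _ x _ => hbound x
      mul_max_le := by
        change k * C * max (S - 0) (0 - -S) ≤ k * C * S - 0
        simp }
  obtain ⟨y, hy0, hy⟩ := hpl.exists_eq_forall_mem_Icc_hasDerivWithinAt₀
  have hnorm : ∀ t ∈ Icc (-S) S, ‖y t‖ ^ 2 = ‖y (-S)‖ ^ 2 := by
    refine constant_of_has_deriv_right_zero (fun t ht => (hy t ht).continuousWithinAt.norm.pow 2)
      fun t ht => ?_
    have h1 := (hy t (Ico_subset_Icc_self ht)).norm_sq
    have h2 : 2 * ⟪y t, f (y t)⟫ = 0 := by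
      simp only [hf, inner_smul_right, inner_drift, mul_zero]
    rw [h2] at h1
    exact (h1.mono_of_mem_nhdsWithin (Icc_mem_nhdsGE_of_mem ht))
  have hnp : ∀ t ∈ Icc (-S) S, ‖y t‖ = ‖p‖ := by
    intro t ht
    have h0 := hnorm 0 (by simp [hS.le])
    rw [← hnorm t ht] at h0
    have hy0' : y 0 = p := hy0
    rw [hy0'] at h0
    exact ((sq_eq_sq₀ (norm_nonneg _) (norm_nonneg _)).1 h0).symm
  refine ⟨y, hy0, hnp, fun t ht => ?_⟩
  have h1 := hy t ht
  have h2 : f (y t) = drift J (y t) := by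
    rw [hf]
    simp only [hnp t ht, ← hk, div_self hk0.ne', one_smul]
  rwa [h2] at h1

/-- A continuous curve solving the controlled equation off a countable set is a trajectory. -/
lemma steers_of_hasDerivAt {J : Fin 3 → ℝ} {T : ℝ} {x₀ x₁ : E3} {u x : ℝ → E3}
    (hT : 0 ≤ T) (hu : MemLp u 2 (volume.restrict (Icc 0 T))) (hx : ContinuousOn x (Icc 0 T))
    {s : Set ℝ} (hs : s.Countable)
    (hd : ∀ t ∈ Ioo 0 T \ s, HasDerivAt x (drift J (x t) + u t) t) (h0 : x 0 = x₀)
    (h1 : x T = x₁) : Steers J T x₀ x₁ u x := by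
  refine ⟨hu, hx, fun t ht => ?_, h1⟩
  have hsub : uIcc 0 t ⊆ Icc 0 T := uIcc_subset_Icc ⟨le_rfl, hT⟩ ht
  have hui : IntegrableOn u (Icc 0 T) := hu.integrable one_le_two
  rw [integral_eq_of_hasDerivAt_off_countable x _ hs (hx.mono hsub), h0]
  · abel
  · intro r hr
    rw [min_eq_left ht.1, max_eq_right ht.1] at hr
    exact hd r ⟨⟨hr.1.1, hr.1.2.trans_le ht.2⟩, hr.2⟩
  · exact (((continuous_drift J).comp_continuousOn hx).mono hsub).intervalIntegrable.add
      (hui.mono_set hsub).intervalIntegrable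

/-- The free motion is slowed down to rest at time `T / 2` along `x₀`, and then accelerated from
rest to `x₁`. Multiplying a free motion by `r` while running it at speed `r` costs only the
control `r'` times the motion, as the drift is homogeneous of degree two; so the
energy is quadratic in the endpoints, although the drift is quadratic itself. -/
theorem exists_steers_energy_le (J : Fin 3 → ℝ) {T : ℝ} (hT : 0 < T) (x₀ x₁ : E3) :
    ∃ u x, Steers J T x₀ x₁ u x ∧
      energy T u ≤ ENNReal.ofReal (2 / T * (‖x₀‖ ^ 2 + ‖x₁‖ ^ 2)) := by
  obtain ⟨y, hy0, hyn, hy⟩ := exists_free_flow J hT x₀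
  -- the drift is even, so a motion run backwards is minus a motion run forwards
  obtain ⟨z, hz0, hzn, hz⟩ := exists_free_flow J hT (-x₁)
  set r : ℝ → ℝ := fun t => 1 - 2 * t / T with hr
  set τ : ℝ → ℝ := fun t => t - t ^ 2 / T with hτ
  have hrd (t : ℝ) : HasDerivAt r (-(2 / T)) t := by
    have := (((hasDerivAt_id t).const_mul 2).div_const T).const_sub 1
    simpa using this
  have hτd (t : ℝ) : HasDerivAt τ (r t) t := by
    have := (hasDerivAt_id t).sub (((hasDerivAt_id t).pow 2).div_const T)
    exact this.congr_deriv (by simp only [hr, id]; ring)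
  have hτm {t : ℝ} (ht : t ∈ Icc 0 T) : τ t ∈ Ico 0 T := by
    have h1 : t ^ 2 / T ≤ t := by
      rw [div_le_iff₀ hT, sq]; exact mul_le_mul_of_nonneg_left ht.2 ht.1
    have h2 : t - t ^ 2 / T < T := by
      rcases ht.2.eq_or_lt with rfl | h
      · rw [sq, mul_div_assoc, div_self hT.ne']; linarith
      · have : 0 ≤ t ^ 2 / T := by positivity
        linarith
    exact ⟨sub_nonneg.2 h1, h2⟩
  have hmem {t : ℝ} (ht : t ∈ Icc 0 T) : τ t ∈ Icc (-T) T :=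
    ⟨by linarith [(hτm ht).1], (hτm ht).2.le⟩
  have hflow {w : ℝ → E3} (hw : ∀ t ∈ Icc (-T) T, HasDerivWithinAt w (drift J (w t)) (Icc (-T) T) t)
      {t : ℝ} (ht : t ∈ Icc 0 T) : HasDerivAt (fun t => r t • w (τ t))
        (drift J (r t • w (τ t)) + -(2 / T) • w (τ t)) t := by
    have h1 : HasDerivAt w (drift J (w (τ t))) (τ t) := (hw _ (hmem ht)).hasDerivAt
      (Icc_mem_nhds (by linarith [(hτm ht).1]) (hτm ht).2)
    have h2 := (hrd t).smul (h1.scomp t (hτd t))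
    refine h2.congr_deriv ?_
    rw [drift_smul, smul_smul, sq]
    rfl
  have hrhalf : r (T / 2) = 0 := by simp only [hr]; field_simp; ring
  set u : ℝ → E3 := fun t => -(2 / T) • (if t ≤ T / 2 then y (τ t) else z (τ t)) with hu
  set x : ℝ → E3 := fun t => if t ≤ T / 2 then r t • y (τ t) else r t • z (τ t) with hx
  have hun : ∀ t ∈ Icc 0 T, ‖u t‖ ^ 2 ≤ 4 / T ^ 2 * (‖x₀‖ ^ 2 + ‖x₁‖ ^ 2) := by
    intro t ht
    have h1 : ‖u t‖ ^ 2 = 4 / T ^ 2 * ‖(if t ≤ T / 2 then y (τ t) else z (τ t))‖ ^ 2 := by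
      rw [hu, norm_smul, mul_pow]
      congr 1
      rw [norm_neg, Real.norm_of_nonneg (by positivity)]
      ring
    rw [h1]
    gcongr
    split_ifs
    · rw [hyn _ (hmem ht)]; nlinarith [sq_nonneg ‖x₁‖]
    · rw [hzn _ (hmem ht), norm_neg]; nlinarith [sq_nonneg ‖x₀‖]
  have hcomp {w : ℝ → E3} (hw : ∀ t ∈ Icc (-T) T, HasDerivWithinAt w (drift J (w t)) (Icc (-T) T) t) :
      ContinuousOn (fun t => w (τ t)) (Icc 0 T) := by
    have hwc : ContinuousOn w (Icc (-T) T) := fun t ht => (hw t ht).continuousWithinAt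
    exact hwc.comp (fun t _ => (hτd t).continuousAt.continuousWithinAt) fun t ht => hmem ht
  have hum : AEStronglyMeasurable u (volume.restrict (Icc 0 T)) := by
    have hpw := AEStronglyMeasurable.piecewise (s := Iic (T / 2))
      (μ := volume.restrict (Icc 0 T)) measurableSet_Iic
      ((hcomp hy).aestronglyMeasurable measurableSet_Icc).restrict
      ((hcomp hz).aestronglyMeasurable measurableSet_Icc).restrict
    exact hpw.const_smul (-(2 / T))
  have huL : MemLp u 2 (volume.restrict (Icc 0 T)) := by
    refine MemLp.of_bound hum (√(4 / T ^ 2 * (‖x₀‖ ^ 2 + ‖x₁‖ ^ 2))) ?_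
    filter_upwards [ae_restrict_mem measurableSet_Icc] with t ht
    exact Real.le_sqrt_of_sq_le (hun t ht)
  have hrc : Continuous r := continuous_iff_continuousAt.2 fun t => (hrd t).continuousAt
  have hxc : ContinuousOn x (Icc 0 T) := by
    refine ContinuousOn.if (fun t ht => ?_) ((hrc.continuousOn.smul (hcomp hy)).mono
      inter_subset_left) ((hrc.continuousOn.smul (hcomp hz)).mono inter_subset_left)
    have : t = T / 2 := frontier_le_subset_eq continuous_id continuous_const ht.2
    rw [this, hrhalf, zero_smul, zero_smul]
  refine ⟨u, x, steers_of_hasDerivAt hT.le huL hxc (countable_singleton (T / 2)) ?_ ?_ ?_, ?_⟩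
  · rintro t ⟨ht, hne⟩
    have ht' := Ioo_subset_Icc_self ht
    rcases lt_or_gt_of_ne hne with hlt | hgt
    · have hev : x =ᶠ[𝓝 t] fun t => r t • y (τ t) := by
        filter_upwards [Iio_mem_nhds hlt] with s hs
        exact if_pos (le_of_lt hs)
      have := (hflow hy ht').congr_of_eventuallyEq hev
      simpa only [hx, hu, if_pos hlt.le] using this
    · have hev : x =ᶠ[𝓝 t] fun t => r t • z (τ t) := by
        filter_upwards [Ioi_mem_nhds hgt] with s hs
        exact if_neg (not_le.2 hs)
      have := (hflow hz ht').congr_of_eventuallyEq hev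
      simpa only [hx, hu, if_neg (not_le.2 hgt)] using this
  · have h1 : (0 : ℝ) ≤ T / 2 := by positivity
    simp [hx, hr, hτ, h1, hy0]
  · have h1 : ¬ T ≤ T / 2 := by linarith
    have h2 : τ T = 0 := by simp only [hτ]; field_simp; ring
    have h3 : r T = -1 := by simp only [hr]; field_simp; ring
    simp [hx, h1, h2, h3, hz0]
  · calc
      energy T u ≤ ∫⁻ _ in Icc 0 T,
          ENNReal.ofReal (1 / 2 * (4 / T ^ 2 * (‖x₀‖ ^ 2 + ‖x₁‖ ^ 2))) :=
        setLIntegral_mono' measurableSet_Icc fun t ht => ENNReal.ofReal_le_ofReal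
          (mul_le_mul_of_nonneg_left (hun t ht) (by norm_num))
      _ = ENNReal.ofReal (2 / T * (‖x₀‖ ^ 2 + ‖x₁‖ ^ 2)) := by
        rw [setLIntegral_const, Real.volume_Icc, sub_zero, ← ENNReal.ofReal_mul (by positivity)]
        congr 1
        field_simp
        ring

/-! ### Weak lower semicontinuity and existence of optimal couplings -/

/-- The Fatou property of lower semicontinuous costs under weak convergence. -/
lemma lintegral_le_liminf_of_lowerSemicontinuous {Ω : Type*} [TopologicalSpace Ω]
    [MeasurableSpace Ω] [OpensMeasurableSpace Ω] [HasOuterApproxClosed Ω] {c : Ω → ℝ≥0∞}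
    (hc : LowerSemicontinuous c) (hfin : ∀ p, c p ≠ ∞) {μ : ProbabilityMeasure Ω}
    {ν : ℕ → ProbabilityMeasure Ω} (hν : Tendsto ν atTop (𝓝 μ)) :
    ∫⁻ p, c p ∂μ ≤ liminf (fun n => ∫⁻ p, c p ∂(ν n : Measure Ω)) atTop := by
  -- the layer cake formula reduces the claim to the open superlevel sets of `c`
  have hlayer (ρ : Measure Ω) : ∫⁻ p, c p ∂ρ = ∫⁻ t in Ioi (0 : ℝ), ρ {p | t < (c p).toReal} := by
    rw [← lintegral_eq_lintegral_meas_lt ρ (Eventually.of_forall fun p => ENNReal.toReal_nonneg)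
      hc.measurable.ennreal_toReal.aemeasurable]
    exact lintegral_congr fun p => (ENNReal.ofReal_toReal (hfin p)).symm
  have hopen : ∀ t ∈ Ioi (0 : ℝ), IsOpen {p | t < (c p).toReal} := by
    intro t ht
    have : {p | t < (c p).toReal} = c ⁻¹' Ioi (ENNReal.ofReal t) := by
      ext p
      exact (ENNReal.ofReal_lt_iff_lt_toReal (le_of_lt ht) (hfin p)).symm
    rw [this]
    exact hc.isOpen_preimage _
  simp_rw [hlayer]
  calc ∫⁻ t in Ioi (0 : ℝ), (μ : Measure Ω) {p | t < (c p).toReal}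
      ≤ ∫⁻ t in Ioi (0 : ℝ), liminf (fun n => (ν n : Measure Ω) {p | t < (c p).toReal}) atTop :=
        setLIntegral_mono' measurableSet_Ioi fun t ht =>
          ProbabilityMeasure.le_liminf_measure_open_of_tendsto hν (hopen t ht)
    _ ≤ _ := lintegral_liminf_le fun n => Antitone.measurable fun s t hst =>
        measure_mono fun p hp => lt_of_le_of_lt hst hp

/-- Two laws have an optimal coupling for every finite lower semicontinuous cost. -/
lemma exists_optimal_coupling {X Y : Type*} [TopologicalSpace X] [MeasurableSpace X]
    [BorelSpace X] [PolishSpace X] [TopologicalSpace Y] [MeasurableSpace Y] [BorelSpace Y]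
    [PolishSpace Y] (μ : ProbabilityMeasure X) (ν : ProbabilityMeasure Y)
    {c : X × Y → ℝ≥0∞} (hc : LowerSemicontinuous c) (hfin : ∀ p, c p ≠ ∞) :
    ∃ π : ProbabilityMeasure (X × Y), (π : Measure (X × Y)).map Prod.fst = μ ∧
      (π : Measure (X × Y)).map Prod.snd = ν ∧
      ∀ π' : ProbabilityMeasure (X × Y), (π' : Measure (X × Y)).map Prod.fst = μ →
        (π' : Measure (X × Y)).map Prod.snd = ν →
        ∫⁻ p, c p ∂(π : Measure (X × Y)) ≤ ∫⁻ p, c p ∂(π' : Measure (X × Y)) := by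
  set S : Set (ProbabilityMeasure (X × Y)) := {π | (π : Measure (X × Y)).map Prod.fst = μ ∧
    (π : Measure (X × Y)).map Prod.snd = ν} with hS
  have hne : S.Nonempty := ⟨⟨(μ : Measure X).prod (ν : Measure Y), inferInstance⟩,
    by constructor <;> simp [Measure.map_fst_prod, Measure.map_snd_prod]⟩
  have hcomp : IsCompact (closure S) := by
    apply isCompact_closure_of_isTightMeasureSet
    apply IsTightMeasureSet.prodMk
    · refine (isTightMeasureSet_singleton (μ := (μ : Measure X))).subset ?_
      rintro _ ⟨_, ⟨π, hπ, rfl⟩, rfl⟩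
      exact hπ.1
    · refine (isTightMeasureSet_singleton (μ := (ν : Measure Y))).subset ?_
      rintro _ ⟨_, ⟨π, hπ, rfl⟩, rfl⟩
      exact hπ.2
  have hclosed : IsClosed S := by
    have h1 : Continuous fun π : ProbabilityMeasure (X × Y) => π.map continuous_fst.aemeasurable :=
      ProbabilityMeasure.continuous_map continuous_fst
    have h2 : Continuous fun π : ProbabilityMeasure (X × Y) => π.map continuous_snd.aemeasurable :=
      ProbabilityMeasure.continuous_map continuous_snd
    have : S = {π | π.map continuous_fst.aemeasurable = μ} ∩
        {π | π.map continuous_snd.aemeasurable = ν} := by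
      ext π
      exact ⟨fun h => ⟨Subtype.ext h.1, Subtype.ext h.2⟩,
        fun h => ⟨congrArg Subtype.val h.1, congrArg Subtype.val h.2⟩⟩
    rw [this]
    exact (isClosed_eq h1 continuous_const).inter (isClosed_eq h2 continuous_const)
  rw [hclosed.closure_eq] at hcomp
  obtain ⟨v, -, hv, hvS⟩ := exists_seq_tendsto_sInf
    (S := (fun π : ProbabilityMeasure (X × Y) => ∫⁻ p, c p ∂(π : Measure (X × Y))) '' S)
    (hne.image _) (OrderBot.bddBelow _)
  choose w hwS hwv using hvS
  obtain ⟨π, hπ, φ, hφ, hlim⟩ := hcomp.isSeqCompact hwS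
  refine ⟨π, hπ.1, hπ.2, fun π' h1 h2 => ?_⟩
  have hle := lintegral_le_liminf_of_lowerSemicontinuous hc hfin hlim
  have hcost : (fun n => ∫⁻ p, c p ∂((w ∘ φ) n : Measure (X × Y))) = v ∘ φ :=
    funext fun n => hwv (φ n)
  rw [hcost, (hv.comp hφ.tendsto_atTop).liminf_eq] at hle
  exact hle.trans (sInf_le ⟨π', ⟨h1, h2⟩, rfl⟩)

/-! ### The ground cost -/

section groundCost

variable (J : Fin 3 → ℝ) {T : ℝ}

lemma groundCost_le (hT : 0 < T) (x₀ x₁ : E3) :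
    groundCost J T x₀ x₁ ≤ ENNReal.ofReal (2 / T * (‖x₀‖ ^ 2 + ‖x₁‖ ^ 2)) := by
  obtain ⟨u, x, h, hE⟩ := exists_steers_energy_le J hT x₀ x₁
  exact (iInf₂_le_of_le u x (iInf_le _ h)).trans hE

lemma groundCost_ne_top (hT : 0 < T) (x₀ x₁ : E3) : groundCost J T x₀ x₁ ≠ ∞ :=
  ((groundCost_le J hT x₀ x₁).trans_lt ENNReal.ofReal_lt_top).ne

variable {J}

/-- Limits of endpoints with asymptotic cost at most `m` are joined with energy at most `m`: the
common source of the existence of optimal controls and of the lower semicontinuity of the cost. -/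
lemma exists_steers_of_groundCost_le (hT : 0 < T) {a b : ℕ → E3} {x₀ x₁ : E3} {m : ℝ≥0}
    (ha : Tendsto a atTop (𝓝 x₀)) (hb : Tendsto b atTop (𝓝 x₁))
    (hc : ∀ n, groundCost J T (a n) (b n) ≤ m) :
    ∃ u x, Steers J T x₀ x₁ u x ∧ energy T u ≤ m := by
  have hM : Tendsto (fun n : ℕ => m + 1 / ((n : ℝ≥0) + 1)) atTop (𝓝 m) := by
    simpa using (tendsto_const_nhds (x := m)).add
      (tendsto_one_div_add_atTop_nhds_zero_nat (𝕜 := ℝ≥0))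
  have hex (n : ℕ) : ∃ u x, Steers J T (a n) (b n) u x ∧
      energy T u ≤ ((m + 1 / ((n : ℝ≥0) + 1) : ℝ≥0) : ℝ≥0∞) := by
    have hlt : groundCost J T (a n) (b n) < ((m + 1 / ((n : ℝ≥0) + 1) : ℝ≥0) : ℝ≥0∞) := by
      refine (hc n).trans_lt (ENNReal.coe_lt_coe.2 (lt_add_of_pos_right _ ?_))
      positivity
    simp only [groundCost, iInf_lt_iff] at hlt
    obtain ⟨u, x, h, hE⟩ := hlt
    exact ⟨u, x, h, hE.le⟩
  choose u x h hE using hex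
  exact exists_steers_of_tendsto hT ha hb hM h hE

lemma exists_optimal_control (hT : 0 < T) (x₀ x₁ : E3) :
    ∃ u x, Steers J T x₀ x₁ u x ∧ energy T u = groundCost J T x₀ x₁ := by
  have hfin := ENNReal.coe_toNNReal (groundCost_ne_top J hT x₀ x₁)
  obtain ⟨u, x, h, hE⟩ := exists_steers_of_groundCost_le (J := J) hT
    (tendsto_const_nhds (x := x₀)) (tendsto_const_nhds (x := x₁)) fun _ : ℕ => hfin.ge
  rw [hfin] at hE
  exact ⟨u, x, h, hE.antisymm (iInf₂_le_of_le u x (iInf_le _ h))⟩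

lemma lowerSemicontinuous_groundCost (hT : 0 < T) :
    LowerSemicontinuous fun p : E3 × E3 => groundCost J T p.1 p.2 := by
  rw [lowerSemicontinuous_iff_isClosed_preimage]
  intro M
  rcases eq_or_ne M ∞ with rfl | hM
  · simp
  lift M to ℝ≥0 using hM
  refine IsSeqClosed.isClosed fun p q hp hpq => ?_
  obtain ⟨u, x, h, hE⟩ := exists_steers_of_groundCost_le hT
    ((continuous_fst.tendsto q).comp hpq) ((continuous_snd.tendsto q).comp hpq) hp
  exact (iInf₂_le_of_le u x (iInf_le _ h)).trans hE

end groundCost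

/-! ### Couplings of probability densities -/

lemma isProbabilityMeasure_law {ξ : E3 → ℝ} (hξ : IsPDF ξ) : IsProbabilityMeasure (law ξ) := by
  refine ⟨?_⟩
  rw [law, withDensity_apply _ MeasurableSet.univ, Measure.restrict_univ,
    ← ofReal_integral_eq_lintegral_ofReal hξ.integrable (Eventually.of_forall hξ.nonneg),
    hξ.integral_eq_one, ENNReal.ofReal_one]

lemma lintegral_norm_sq_law_lt_top {ξ : E3 → ℝ} (hξ : IsPDF ξ)
    (hm : Integrable fun x => ‖x‖ ^ 2 * ξ x) :
    ∫⁻ x, ENNReal.ofReal (‖x‖ ^ 2) ∂(law ξ) < ∞ := by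
  rw [law, lintegral_withDensity_eq_lintegral_mul₀
    hξ.integrable.aestronglyMeasurable.aemeasurable.ennreal_ofReal (by fun_prop)]
  refine lt_of_eq_of_lt (lintegral_congr fun x => ?_) hm.lintegral_lt_top
  rw [Pi.mul_apply, ← ENNReal.ofReal_mul (hξ.nonneg x), mul_comm]

lemma lintegral_norm_sq_lt_top_of_map_eq_law {ξ₀ ξ₁ : E3 → ℝ} (hξ₀ : IsPDF ξ₀) (hξ₁ : IsPDF ξ₁)
    (hm₀ : Integrable fun x => ‖x‖ ^ 2 * ξ₀ x) (hm₁ : Integrable fun x => ‖x‖ ^ 2 * ξ₁ x)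
    {π : Measure (E3 × E3)} (h₀ : π.map Prod.fst = law ξ₀) (h₁ : π.map Prod.snd = law ξ₁) :
    ∫⁻ p, ENNReal.ofReal (‖p.1‖ ^ 2 + ‖p.2‖ ^ 2) ∂π < ∞ := by
  have hmeas : Measurable fun x : E3 => ENNReal.ofReal (‖x‖ ^ 2) := by fun_prop
  have h (p : E3 × E3) : ENNReal.ofReal (‖p.1‖ ^ 2 + ‖p.2‖ ^ 2)
      = ENNReal.ofReal (‖p.1‖ ^ 2) + ENNReal.ofReal (‖p.2‖ ^ 2) :=
    ENNReal.ofReal_add (by positivity) (by positivity)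
  have e₀ : ∫⁻ p, ENNReal.ofReal (‖p.1‖ ^ 2) ∂π = ∫⁻ x, ENNReal.ofReal (‖x‖ ^ 2) ∂(law ξ₀) := by
    rw [← h₀, lintegral_map hmeas measurable_fst]
  have e₁ : ∫⁻ p, ENNReal.ofReal (‖p.2‖ ^ 2) ∂π = ∫⁻ x, ENNReal.ofReal (‖x‖ ^ 2) ∂(law ξ₁) := by
    rw [← h₁, lintegral_map hmeas measurable_snd]
  simp_rw [h]
  rw [lintegral_add_left (by fun_prop), e₀, e₁]
  exact ENNReal.add_lt_top.2
    ⟨lintegral_norm_sq_law_lt_top hξ₀ hm₀, lintegral_norm_sq_law_lt_top hξ₁ hm₁⟩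

lemma transportCost_lt_top (J : Fin 3 → ℝ) {T : ℝ} (hT : 0 < T) {π : Measure (E3 × E3)}
    (hπ : ∫⁻ p, ENNReal.ofReal (‖p.1‖ ^ 2 + ‖p.2‖ ^ 2) ∂π < ∞) : transportCost J T π < ∞ := by
  calc transportCost J T π
      ≤ ∫⁻ p, ENNReal.ofReal (2 / T) * ENNReal.ofReal (‖p.1‖ ^ 2 + ‖p.2‖ ^ 2) ∂π := by
        refine lintegral_mono fun p => (groundCost_le J hT p.1 p.2).trans_eq ?_
        rw [ENNReal.ofReal_mul (by positivity)]
    _ < ∞ := by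
        rw [lintegral_const_mul _ (by fun_prop)]
        exact ENNReal.mul_lt_top ENNReal.ofReal_lt_top hπ

end EulerOT

theorem theorem1 (J : Fin 3 → ℝ) (hJ : ∀ i, 0 < J i) (T : ℝ) (hT : 0 < T)
    (ξ₀ ξ₁ : EulerOT.E3 → ℝ) (hξ₀ : EulerOT.IsPDF ξ₀) (hξ₁ : EulerOT.IsPDF ξ₁)
    (hm₀ : Integrable (fun x => ‖x‖ ^ 2 * ξ₀ x))
    (hm₁ : Integrable (fun x => ‖x‖ ^ 2 * ξ₁ x)) :
    (∀ x₀ x₁ : EulerOT.E3, ∃ u x : ℝ → EulerOT.E3, EulerOT.Steers J T x₀ x₁ u x ∧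
      EulerOT.energy T u = EulerOT.groundCost J T x₀ x₁ ∧
      EulerOT.groundCost J T x₀ x₁ < ∞) ∧
    Measurable (fun p : EulerOT.E3 × EulerOT.E3 => EulerOT.groundCost J T p.1 p.2) ∧
    ∃ π ∈ EulerOT.couplings ξ₀ ξ₁,
      EulerOT.transportCost J T π < ∞ ∧
      ∀ π' ∈ EulerOT.couplings ξ₀ ξ₁,
        EulerOT.transportCost J T π ≤ EulerOT.transportCost J T π' := by
  have hlsc := EulerOT.lowerSemicontinuous_groundCost (J := J) hT
  refine ⟨fun x₀ x₁ => ?_, hlsc.measurable, ?_⟩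
  · obtain ⟨u, x, h, hE⟩ := EulerOT.exists_optimal_control (J := J) hT x₀ x₁
    exact ⟨u, x, h, hE, (EulerOT.groundCost_ne_top J hT x₀ x₁).lt_top⟩
  · obtain ⟨π, h₀, h₁, hopt⟩ := EulerOT.exists_optimal_coupling
      ⟨EulerOT.law ξ₀, EulerOT.isProbabilityMeasure_law hξ₀⟩
      ⟨EulerOT.law ξ₁, EulerOT.isProbabilityMeasure_law hξ₁⟩ hlsc
      fun p => EulerOT.groundCost_ne_top J hT p.1 p.2
    have hπ := EulerOT.lintegral_norm_sq_lt_top_of_map_eq_law hξ₀ hξ₁ hm₀ hm₁ h₀ h₁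
    exact ⟨π, ⟨π.2, h₀, h₁, hπ⟩, EulerOT.transportCost_lt_top J hT hπ,
      fun π' hπ' => hopt ⟨π', hπ'.1⟩ hπ'.2.1 hπ'.2.2.1⟩
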